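/- Let $(V_1,V_2)$ be a pair of commuting isometries on a complex Hilbert space $\mathcal H$ whose defect operator $$C(V_1,V_2)=I-V_1V_1^*-V_2V_2^*+V_1V_2V_2^*V_1^*$$ satisfies $C(V_1,V_2)\le 0$ and $C(V_1,V_2)\neq 0$. Let $(\mathcal E,P,U)$ be the Berger–Coburn–Lebow (BCL) triple for $(V_1,V_2)$: $P$ is an orthogonal projection and $U$ a unitary on the complex Hilbert space $\mathcal E$, and $\mathcal H=\mathcal H_p\oplus\mathcal H_u$ with both summands reducing $V_1,V_2$, where $V_1|_{\mathcal H_u},V_2|_{\mathcal H_u}$ are unitaries and $(V_1|_{\mathcal H_p},V_2|_{\mathcal H_p})$ is jointly unitarily equivalent to the pair $(M_{\varphi_1},M_{\varphi_2})$ of multiplication operators on the Hardy space $H^2_{\mathbb D}(\mathcal E)$ by $$\varphi_1(z)=U^*(P^\perp+zP),\qquad \varphi_2(z)=(P+zP^\perp)U\qquad(z\in\mathbb D).$$ For commuting bounded operators $T_1,T_2$ on a Hilbert space $X$, let $K(T_1,T_2)$ be the Koszul complex $$0\xrightarrow{\delta_0}X\xrightarrow{\delta_1}X\oplus X\xrightarrow{\delta_2}X\xrightarrow{\delta_3}0,\qquad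 \delta_1h=(T_1h,T_2h),\quad \delta_2(h_1,h_2)=T_1h_2-T_2h_1.$$ Its non-singularity breaks at stage $n$ if $\operatorname{ran}\delta_{n-1}\ne\ker\delta_n$. The Taylor joint spectrum $\sigma(T_1,T_2)$ is the set of $(\lambda_1,\lambda_2)\in\mathbb C^2$ for which the non-singularity of $K(T_1-\lambda_1I,T_2-\lambda_2I)$ breaks at some stage $n\in\{1,2,3\}$. Then for every $z\in\mathbb D$: 1. every $(\lambda_1,\lambda_2)\in\mathbb D^2$ with $\lambda_1\lambda_2=z$ is a joint eigenvalue of $(\varphi_1(z),\varphi_2(z))$; 2. $\sigma(\varphi_1(z),\varphi_2(z))=\{(\lambda_1,\lambda_2)\in\overline{\mathbb D^2}:\lambda_1\lambda_2=z\}$, and for each point $(\lambda_1,\lambda_2)$ of this set the non-singularity of $K(\varphi_1(z)-\lambda_1I,\varphi_2(z)-\lambda_2I)$ breaks at stage 2. Moreover $$\sigma(V_1,V_2)=\sigma(M_{\varphi_1},M_{\varphi_2})=\overline{\bigcup_{z\in\mathbb D}\sigma(\varphi_1(z),\varphi_2(z))}=\overline{\mathbb D^2},$$ and for every $(\lambda_1,\lambda_2)\in\mathbb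 D^2$ the non-singularity of both $K(V_1-\lambda_1I,V_2-\lambda_2I)$ and $K(M_{\varphi_1}-\lambda_1I,M_{\varphi_2}-\lambda_2I)$ breaks at stage 2. -/

import Mathlib

open scoped InnerProductSpace

noncomputable section

namespace IsometricPair

/-! ### The Koszul complex and the Taylor joint spectrum of a pair of operators -/

section Koszul

variable {X : Type*} [NormedAddCommGroup X] [NormedSpace ℂ X]

/-- The map `δ₁ : X → X ⊕ X`, `h ↦ (T₁ h, T₂ h)`. -/
def koszulDelta1 (T₁ T₂ : X →L[ℂ] X) : X →ₗ[ℂ] X × X :=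
  (T₁ : X →ₗ[ℂ] X).prod (T₂ : X →ₗ[ℂ] X)

/-- The map `δ₂ : X ⊕ X → X`, `(h₁, h₂) ↦ T₁ h₂ - T₂ h₁`. -/
def koszulDelta2 (T₁ T₂ : X →L[ℂ] X) : X × X →ₗ[ℂ] X :=
  (T₁ : X →ₗ[ℂ] X) ∘ₗ LinearMap.snd ℂ X X - (T₂ : X →ₗ[ℂ] X) ∘ₗ LinearMap.fst ℂ X X

/-- Exactness of `0 → X → X ⊕ X → X → 0` fails at the first `X`: `ran δ₀ = 0 ≠ ker δ₁`. -/
def BreaksAtStage1 (T₁ T₂ : X →L[ℂ] X) : Prop :=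
  (⊥ : Submodule ℂ X) ≠ LinearMap.ker (koszulDelta1 T₁ T₂)

/-- Exactness fails at `X ⊕ X`: `ran δ₁ ≠ ker δ₂`. -/
def BreaksAtStage2 (T₁ T₂ : X →L[ℂ] X) : Prop :=
  LinearMap.range (koszulDelta1 T₁ T₂) ≠ LinearMap.ker (koszulDelta2 T₁ T₂)

/-- Exactness fails at the last `X`: `ran δ₂ ≠ ker δ₃ = X`. -/
def BreaksAtStage3 (T₁ T₂ : X →L[ℂ] X) : Prop :=
  LinearMap.range (koszulDelta2 T₁ T₂) ≠ (⊤ : Submodule ℂ X)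

/-- The pair `(T₁, T₂)` is singular: its Koszul complex is not exact. -/
def IsSingularPair (T₁ T₂ : X →L[ℂ] X) : Prop :=
  BreaksAtStage1 T₁ T₂ ∨ BreaksAtStage2 T₁ T₂ ∨ BreaksAtStage3 T₁ T₂

/-- The Taylor joint spectrum of a (commuting) pair of bounded operators. -/
def jointSpectrum (T₁ T₂ : X →L[ℂ] X) : Set (ℂ × ℂ) :=
  {p | IsSingularPair (T₁ - p.1 • 1) (T₂ - p.2 • 1)}

/-- `p` is a joint eigenvalue of `(T₁, T₂)`. -/
def IsJointEigenvalue (T₁ T₂ : X →L[ℂ] X) (p : ℂ × ℂ) : Prop :=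
  ∃ x : X, x ≠ 0 ∧ T₁ x = p.1 • x ∧ T₂ x = p.2 • x

end Koszul

/-! ### The Hardy space of the disc -/

section Hardy

variable (E : Type*) [NormedAddCommGroup E] [InnerProductSpace ℂ E]

/-- The `E`-valued Hardy space on the unit disc: the function `f(z) = ∑ aₙ zⁿ` is represented by
its square summable sequence of Taylor coefficients, with the inner product `∑ ⟪aₙ, bₙ⟫`. -/
abbrev Hardy : Type _ := lp (fun _ : ℕ => E) 2

variable {E}

/-- The value `f(z) = ∑ aₙ zⁿ` of an element of the Hardy space at a point `z` of the disc. -/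
def Hardy.eval (f : Hardy E) (z : ℂ) : E := ∑' n : ℕ, z ^ n • f n

/-- `(a₀, a₁, …) ↦ (0, a₀, a₁, …)` on sequences. -/
def shiftSeq (a : ℕ → E) : ℕ → E
  | 0 => 0
  | n + 1 => a n

theorem memlp_shiftSeq (f : Hardy E) : Memℓp (shiftSeq (f : ℕ → E)) 2 := by
  have h := (memℓp_gen_iff (p := 2) (by norm_num)).1 (lp.memℓp f)
  refine (memℓp_gen_iff (p := 2) (by norm_num)).2 ?_
  exact (summable_nat_add_iff 1).1 (by simpa [shiftSeq] using h)

theorem norm_shiftSeq (f : Hardy E) :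
    ‖(⟨shiftSeq (f : ℕ → E), memlp_shiftSeq f⟩ : Hardy E)‖ = ‖f‖ := by
  have h2 : 0 < (2 : ENNReal).toReal := by norm_num
  have hs := (memℓp_gen_iff (p := 2) h2).1 (memlp_shiftSeq f)
  rw [lp.norm_eq_tsum_rpow h2, lp.norm_eq_tsum_rpow h2]
  congr 1
  rw [hs.tsum_eq_zero_add]
  simp [shiftSeq]

/-- Multiplication by the coordinate, `M_z ⊗ I` on the Hardy space. -/
def mulZ : Hardy E →L[ℂ] Hardy E :=
  LinearMap.mkContinuous
    { toFun := fun f => ⟨shiftSeq (f : ℕ → E), memlp_shiftSeq f⟩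
      map_add' := fun f g => by
        ext n
        cases n
        · exact (add_zero (0 : E)).symm
        · rfl
      map_smul' := fun c f => by
        ext n
        cases n <;> simp [shiftSeq] }
    1 (fun f => by simpa using (norm_shiftSeq f).le)

theorem memlp_coeff (A : E →L[ℂ] E) (f : Hardy E) : Memℓp (fun n => A (f n)) 2 := by
  have h2 : 0 < (2 : ENNReal).toReal := by norm_num
  have h := (memℓp_gen_iff (p := 2) h2).1 (lp.memℓp f)
  refine (memℓp_gen_iff (p := 2) h2).2
    (Summable.of_nonneg_of_le (fun n => by positivity) (fun n => ?_)
      (h.mul_left (‖A‖ ^ (2 : ENNReal).toReal)))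
  rw [← Real.mul_rpow (norm_nonneg _) (norm_nonneg _)]
  exact Real.rpow_le_rpow (norm_nonneg _) (A.le_opNorm _) h2.le

theorem norm_coeff_le (A : E →L[ℂ] E) (f : Hardy E) :
    ‖(⟨fun n => A (f n), memlp_coeff A f⟩ : Hardy E)‖ ≤ ‖A‖ * ‖f‖ := by
  have h2 : 0 < (2 : ENNReal).toReal := by norm_num
  refine lp.norm_le_of_tsum_le h2 (by positivity) ?_
  have h := (memℓp_gen_iff (p := 2) h2).1 (lp.memℓp f)
  have hA := (memℓp_gen_iff (p := 2) h2).1 (memlp_coeff A f)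
  rw [Real.mul_rpow (norm_nonneg _) (norm_nonneg _), lp.norm_rpow_eq_tsum h2 f, ← tsum_mul_left]
  refine hA.tsum_le_tsum (fun n => ?_) (h.mul_left _)
  rw [← Real.mul_rpow (norm_nonneg _) (norm_nonneg _)]
  exact Real.rpow_le_rpow (norm_nonneg _) (A.le_opNorm _) h2.le

/-- Multiplication by the constant operator `A`, `I ⊗ A` on the Hardy space. -/
def mulConst (A : E →L[ℂ] E) : Hardy E →L[ℂ] Hardy E :=
  LinearMap.mkContinuous
    { toFun := fun f => ⟨fun n => A (f n), memlp_coeff A f⟩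
      map_add' := fun f g => by
        ext n
        exact A.map_add (f n) (g n)
      map_smul' := fun c f => by
        ext n
        simp }
    ‖A‖ (norm_coeff_le A)

end Hardy

/-! ### Berger-Coburn-Lebow triples -/

section BCL

variable {E : Type*} [NormedAddCommGroup E] [InnerProductSpace ℂ E] [CompleteSpace E]

/-- `φ₁(z) = U* (P^⊥ + z P)`. -/
def phi1 (P U : E →L[ℂ] E) (z : ℂ) : E →L[ℂ] E := star U * ((1 - P) + z • P)

/-- `φ₂(z) = (P + z P^⊥) U`. -/
def phi2 (P U : E →L[ℂ] E) (z : ℂ) : E →L[ℂ] E := (P + z • (1 - P)) * U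

/-- The multiplication operator `M_{φ₁} = I ⊗ U* P^⊥ + M_z ⊗ U* P` on the Hardy space. -/
def mulPhi1 (P U : E →L[ℂ] E) : Hardy E →L[ℂ] Hardy E :=
  mulConst (star U * (1 - P)) + mulZ * mulConst (star U * P)

/-- The multiplication operator `M_{φ₂} = I ⊗ P U + M_z ⊗ P^⊥ U` on the Hardy space. -/
def mulPhi2 (P U : E →L[ℂ] E) : Hardy E →L[ℂ] Hardy E :=
  mulConst (P * U) + mulZ * mulConst ((1 - P) * U)

theorem Hardy.summable (f : Hardy E) {z : ℂ} (hz : z ∈ Metric.ball (0 : ℂ) 1) :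
    Summable fun n : ℕ => z ^ n • f n := by
  have hz' : ‖z‖ < 1 := by simpa using hz
  refine Summable.of_norm_bounded (g := fun n => ‖z‖ ^ n * ‖f‖)
    ((summable_geometric_of_lt_one (norm_nonneg _) hz').mul_right _) (fun n => ?_)
  rw [norm_smul, norm_pow]
  gcongr
  exact lp.norm_apply_le_norm (by norm_num) f n

/-- An element of the Hardy space is determined by its values on the disc. -/
theorem Hardy.eq_of_eval_eq (f g : Hardy E)
    (h : ∀ z ∈ Metric.ball (0 : ℂ) 1, Hardy.eval f z = Hardy.eval g z) : f = g := by
  let p : Hardy E → FormalMultilinearSeries ℂ ℂ E := fun u n =>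
    ContinuousMultilinearMap.mkPiRing ℂ (Fin n) (u n)
  have hc : ∀ u n, (p u).coeff n = u n := fun u n => by
    simp [p, FormalMultilinearSeries.coeff]
  have hp : ∀ u : Hardy E, HasFPowerSeriesAt (Hardy.eval u) (p u) 0 := fun u => by
    rw [hasFPowerSeriesAt_iff]
    filter_upwards [Metric.ball_mem_nhds (0 : ℂ) one_pos] with z hz
    simp only [hc, zero_add]
    exact (Hardy.summable u hz).hasSum
  have hfg : Hardy.eval f =ᶠ[nhds 0] Hardy.eval g := by
    filter_upwards [Metric.ball_mem_nhds (0 : ℂ) one_pos] with z hz using h z hz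
  have hpp := ((hp f).congr hfg).eq_formalMultilinearSeries (hp g)
  ext n
  rw [← hc f n, ← hc g n, hpp]

theorem Hardy.eval_add (f g : Hardy E) {z : ℂ} (hz : z ∈ Metric.ball (0 : ℂ) 1) :
    Hardy.eval (f + g) z = Hardy.eval f z + Hardy.eval g z := by
  simp only [Hardy.eval, lp.coeFn_add, Pi.add_apply, smul_add]
  exact (Hardy.summable f hz).tsum_add (Hardy.summable g hz)

theorem Hardy.eval_mulConst (A : E →L[ℂ] E) (f : Hardy E) {z : ℂ}
    (hz : z ∈ Metric.ball (0 : ℂ) 1) : Hardy.eval (mulConst A f) z = A (Hardy.eval f z) := by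
  have h := A.map_tsum (Hardy.summable f hz)
  simp only [map_smul] at h
  exact h.symm

theorem Hardy.eval_mulZ (f : Hardy E) {z : ℂ} (hz : z ∈ Metric.ball (0 : ℂ) 1) :
    Hardy.eval (mulZ f) z = z • Hardy.eval f z := by
  have h := (Hardy.summable (mulZ f) hz).tsum_eq_zero_add
  have h0 : (mulZ f) 0 = 0 := rfl
  have h1 : ∀ n, (mulZ f) (n + 1) = f n := fun _ => rfl
  simp only [h0, h1, smul_zero, zero_add, pow_succ', mul_smul] at h
  unfold Hardy.eval
  rw [h, (Hardy.summable f hz).tsum_const_smul]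

/-- `mulPhi1` is pointwise multiplication by `φ₁` on the disc. -/
theorem Hardy.eval_mulPhi1 (P U : E →L[ℂ] E) (f : Hardy E) {z : ℂ}
    (hz : z ∈ Metric.ball (0 : ℂ) 1) :
    Hardy.eval (mulPhi1 P U f) z = phi1 P U z (Hardy.eval f z) := by
  change Hardy.eval (mulConst _ f + mulZ (mulConst _ f)) z = _
  rw [Hardy.eval_add _ _ hz, Hardy.eval_mulZ _ hz, Hardy.eval_mulConst _ _ hz,
    Hardy.eval_mulConst _ _ hz]
  simp [phi1]

/-- `mulPhi2` is pointwise multiplication by `φ₂` on the disc. -/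
theorem Hardy.eval_mulPhi2 (P U : E →L[ℂ] E) (f : Hardy E) {z : ℂ}
    (hz : z ∈ Metric.ball (0 : ℂ) 1) :
    Hardy.eval (mulPhi2 P U f) z = phi2 P U z (Hardy.eval f z) := by
  change Hardy.eval (mulConst _ f + mulZ (mulConst _ f)) z = _
  rw [Hardy.eval_add _ _ hz, Hardy.eval_mulZ _ hz, Hardy.eval_mulConst _ _ hz,
    Hardy.eval_mulConst _ _ hz]
  simp [phi2]

variable {H : Type*} [NormedAddCommGroup H] [InnerProductSpace ℂ H] [CompleteSpace H]

/-- The defect operator `I - V₁V₁* - V₂V₂* + V₁V₂V₂*V₁*`. -/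
def defect (V₁ V₂ : H →L[ℂ] H) : H →L[ℂ] H :=
  1 - V₁ * star V₁ - V₂ * star V₂ + V₁ * V₂ * star V₂ * star V₁

/-- `(E, P, U)` is the BCL triple of the pair `(V₁, V₂)`: `P` is an orthogonal projection and `U` a
unitary on `E`, and `H = Hp ⊕ Hp^⊥` where both summands reduce `V₁` and `V₂`, the pair
`(V₁|Hp, V₂|Hp)` is unitarily equivalent to `(M_{φ₁}, M_{φ₂})` on the Hardy space of `E`, and
`V₁`, `V₂` restrict to unitaries of `Hp^⊥`. -/
structure IsBCLTriple (P U : E →L[ℂ] E) (V₁ V₂ : H →L[ℂ] H) : Prop where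
  projection : IsStarProjection P
  unitary : U ∈ unitary (E →L[ℂ] E)
  decomposition : ∃ (Hp : Submodule ℂ H) (W : Hardy E ≃ₗᵢ[ℂ] Hp) (W₁ W₂ : Hpᗮ ≃ₗᵢ[ℂ] Hpᗮ),
    (∀ f : Hardy E, V₁ (W f) = W (mulPhi1 P U f)) ∧
    (∀ f : Hardy E, V₂ (W f) = W (mulPhi2 P U f)) ∧
    (∀ x : Hpᗮ, V₁ x = W₁ x) ∧
    (∀ x : Hpᗮ, V₂ x = W₂ x)

end BCL

/-- The open bidisc. -/
def openBidisc : Set (ℂ × ℂ) := Metric.ball (0 : ℂ) 1 ×ˢ Metric.ball (0 : ℂ) 1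

/-- The closed bidisc. -/
def closedBidisc : Set (ℂ × ℂ) := Metric.closedBall (0 : ℂ) 1 ×ˢ Metric.closedBall (0 : ℂ) 1

end IsometricPair

end

namespace IsometricPair

/-! ### Algebra of the Koszul complex -/

section KoszulExact

variable {X : Type*} [NormedAddCommGroup X] [NormedSpace ℂ X]

/-! On constants the defect of the Hardy space pair acts as `U*PU - P`. Nonpositivity gives `‖PUx‖ ≤
‖Px‖`, so `U` preserves `ker P` and `U*` preserves `ran P`; nonvanishing gives a wandering vector `e
≠ 0` with `Pe = e`, `PUe = 0` (`IsBCLTriple.exists_wandering`).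

For `(a, b)` in the open bidisc put `y = ∑ bⁿU*ⁿe ∈ ran P` and `w = ∑ aⁿUⁿ⁺¹e ∈ ker P`. For every
`z`, `(φ₁(z) - a)w = e = (φ₂(z) - b)U*y`, so `(U*y, w)` is a Koszul cycle independent of `z`. At `z
= ab` it is not a boundary (`phi_sub_ne`), and `y + aw` is a joint eigenvector. As constant
functions the same vectors form a cycle on the Hardy space, where evaluation at `ab` rules out a
boundary; orthogonal decomposition carries this to `(V₁, V₂)`.

The upper bounds on the spectra come from contractivity and from `φ₁φ₂ = φ₂φ₁ = z`, by Bezout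
identities. Boundary points are reached by stability: exactness at stages 2 and 3 forces exactness
at stage 2 nearby (`eventually_not_breaksAtStage2`). On a fibre, stage 3 comes for free away from
the origin (`breaksAtStage2_of_breaksAtStage3`), so the break at stage 2 itself persists on the
boundary. -/

theorem breaksAtStage2_of_notMem_range {A B : X →L[ℂ] X} {h₁ h₂ : X} (h : A h₂ = B h₁)
    (hn : ∀ x, A x = h₁ → B x ≠ h₂) : BreaksAtStage2 A B := by
  intro heq
  have hm : (h₁, h₂) ∈ LinearMap.ker (koszulDelta2 A B) := by
    simp [koszulDelta2, h]
  rw [← heq] at hm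
  obtain ⟨x, hx⟩ := hm
  exact hn x (congrArg Prod.fst hx) (congrArg Prod.snd hx)

theorem breaksAtStage2_iff {A B : X →L[ℂ] X} (hAB : ∀ x, A (B x) = B (A x)) :
    BreaksAtStage2 A B ↔ ∃ h₁ h₂ : X, A h₂ = B h₁ ∧ ∀ x, A x = h₁ → B x ≠ h₂ := by
  refine ⟨fun h => ?_, fun ⟨h₁, h₂, h, hn⟩ => breaksAtStage2_of_notMem_range h hn⟩
  by_contra! hc
  refine h (le_antisymm ?_ ?_)
  · rintro _ ⟨x, rfl⟩
    simp [koszulDelta1, koszulDelta2, hAB]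
  · rintro ⟨h₁, h₂⟩ hm
    obtain ⟨x, hx₁, hx₂⟩ := hc h₁ h₂ (by simpa [koszulDelta2, sub_eq_zero] using hm)
    exact ⟨x, by simp [koszulDelta1, hx₁, hx₂]⟩

/-- A pair `(A, B)` with `C A + D B = 1` for some `C`, `D` commuting with it is nonsingular. -/
theorem not_isSingularPair_of_bezout {A B C D : X →L[ℂ] X} (hAB : Commute A B)
    (hCA : Commute C A) (hCB : Commute C B) (hDA : Commute D A) (hDB : Commute D B)
    (h1 : C * A + D * B = 1) : ¬ IsSingularPair A B := by
  have e1 : ∀ x, C (A x) + D (B x) = x := fun x => DFunLike.congr_fun h1 x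
  have eAB : ∀ x, A (B x) = B (A x) := fun x => DFunLike.congr_fun hAB.eq x
  have eCA : ∀ x, C (A x) = A (C x) := fun x => DFunLike.congr_fun hCA.eq x
  have eCB : ∀ x, C (B x) = B (C x) := fun x => DFunLike.congr_fun hCB.eq x
  have eDA : ∀ x, D (A x) = A (D x) := fun x => DFunLike.congr_fun hDA.eq x
  have eDB : ∀ x, D (B x) = B (D x) := fun x => DFunLike.congr_fun hDB.eq x
  rintro (h | h | h)
  · refine h (le_antisymm bot_le fun x hx => ?_)
    have hA : A x = 0 := congrArg Prod.fst hx
    have hB : B x = 0 := congrArg Prod.snd hx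
    rw [Submodule.mem_bot, ← e1 x, hA, hB, map_zero, map_zero, add_zero]
  · obtain ⟨h₁, h₂, h, hn⟩ := (breaksAtStage2_iff eAB).1 h
    -- The coefficients `C`, `D` give a contracting homotopy of the complex; this is its value on
    -- the cycle.
    refine hn (C h₁ + D h₂) ?_ ?_
    · rw [map_add, ← eCA, ← eDA, h, e1]
    · rw [map_add, ← eCB, ← h, ← eDB, e1]
  · refine h (eq_top_iff.2 fun x _ => ⟨(-D x, C x), ?_⟩)
    simp [koszulDelta2, ← eCA, ← eDB, e1]

/-- Off the closed bidisc one of the two shifted operators is invertible; its inverse and `0` are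
Bezout coefficients. -/
theorem norm_le_one_of_mem_jointSpectrum [CompleteSpace X] {T₁ T₂ : X →L[ℂ] X}
    (hT : Commute T₁ T₂) (h₁ : ‖T₁‖ ≤ 1) (h₂ : ‖T₂‖ ≤ 1) {p : ℂ × ℂ}
    (hp : p ∈ jointSpectrum T₁ T₂) : p ∈ closedBidisc := by
  have key : ∀ (T : X →L[ℂ] X) (c : ℂ), ‖T‖ ≤ 1 → 1 < ‖c‖ → IsUnit (T - c • 1) := by
    intro T c hT hc
    have hmem := spectrum.mem_resolventSet_of_norm_lt_mul (𝕜 := ℂ) (a := T) (k := c) (by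
      have : ‖(1 : X →L[ℂ] X)‖ ≤ 1 := ContinuousLinearMap.norm_id_le
      calc ‖T‖ * ‖(1 : X →L[ℂ] X)‖ ≤ 1 * 1 := by gcongr
        _ < ‖c‖ := by simpa using hc)
    have := (spectrum.mem_resolventSet_iff.1 hmem).neg
    rwa [neg_sub, Algebra.algebraMap_eq_smul_one] at this
  have hc : Commute (T₁ - p.1 • 1) (T₂ - p.2 • 1) :=
    (hT.sub_right ((Commute.one_right _).smul_right _)).sub_left
      ((Commute.one_left _).smul_left _)
  simp only [closedBidisc, Set.mem_prod, mem_closedBall_zero_iff]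
  by_contra hn
  rw [not_and_or, not_le, not_le] at hn
  rcases hn with hn | hn
  · obtain ⟨u, hu⟩ := key T₁ p.1 h₁ hn
    have hp : IsSingularPair _ _ := hp
    rw [← hu] at hp
    rw [← hu] at hc
    exact not_isSingularPair_of_bezout (C := ↑u⁻¹) (D := 0) hc
      ((Commute.refl (u : X →L[ℂ] X)).units_inv_left) hc.units_inv_left
      (Commute.zero_left _) (Commute.zero_left _) (by simp) hp
  · obtain ⟨u, hu⟩ := key T₂ p.2 h₂ hn
    have hp : IsSingularPair _ _ := hp
    rw [← hu] at hp
    rw [← hu] at hc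
    exact not_isSingularPair_of_bezout (C := 0) (D := ↑u⁻¹) hc
      (Commute.zero_left _) (Commute.zero_left _)
      hc.symm.units_inv_left ((Commute.refl (u : X →L[ℂ] X)).units_inv_left) (by simp) hp

/-- The identity `p₂(T₁ - p₁) + T₁(T₂ - p₂) = T₁T₂ - p₁p₂` has the scalar `z - p₁p₂` on the right;
dividing by it gives Bezout coefficients. -/
theorem mul_eq_of_mem_jointSpectrum {T₁ T₂ : X →L[ℂ] X} {z : ℂ}
    (h12 : T₁ * T₂ = z • 1) (h21 : T₂ * T₁ = z • 1) {p : ℂ × ℂ}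
    (hp : p ∈ jointSpectrum T₁ T₂) : p.1 * p.2 = z := by
  by_contra hne
  have hne' : z - p.1 * p.2 ≠ 0 := sub_ne_zero.2 (Ne.symm hne)
  have hT : Commute T₁ T₂ := h12.trans h21.symm
  have hs : ∀ (S : X →L[ℂ] X) (c : ℂ), Commute S (c • 1) := fun S c =>
    (Commute.one_right S).smul_right c
  refine not_isSingularPair_of_bezout (C := ((z - p.1 * p.2)⁻¹ * p.2) • 1)
    (D := (z - p.1 * p.2)⁻¹ • T₁)
    ((hT.sub_right (hs _ _)).sub_left ((hs _ _).symm.sub_right (hs _ _)))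
    (hs _ _).symm (hs _ _).symm
    (((Commute.refl _).sub_right (hs _ _)).smul_left _) ((hT.sub_right (hs _ _)).smul_left _) ?_ hp
  have : ((z - p.1 * p.2)⁻¹ * p.2) • (1 : X →L[ℂ] X) * (T₁ - p.1 • 1) +
      (z - p.1 * p.2)⁻¹ • T₁ * (T₂ - p.2 • 1) =
      (z - p.1 * p.2)⁻¹ • (T₁ * T₂ - (p.1 * p.2) • 1) := by
    simp only [smul_mul_assoc, one_mul, mul_sub, mul_smul_comm, mul_one]
    module
  rw [this, h12, ← sub_smul, smul_smul, inv_mul_cancel₀ hne', one_smul]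

/-- If `T₁ T₂ = p₁ p₂` with `p ≠ 0`, exactness in the middle implies exactness at the end. -/
theorem breaksAtStage2_of_breaksAtStage3 {T₁ T₂ : X →L[ℂ] X} {p : ℂ × ℂ}
    (h12 : T₁ * T₂ = (p.1 * p.2) • 1) (h21 : T₂ * T₁ = (p.1 * p.2) • 1) (hp : p ≠ 0)
    (h3 : BreaksAtStage3 (T₁ - p.1 • 1) (T₂ - p.2 • 1)) :
    BreaksAtStage2 (T₁ - p.1 • 1) (T₂ - p.2 • 1) := by
  have e12 : ∀ x, T₁ (T₂ x) = (p.1 * p.2) • x := fun x => DFunLike.congr_fun h12 x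
  have e21 : ∀ x, T₂ (T₁ x) = (p.1 * p.2) • x := fun x => DFunLike.congr_fun h21 x
  by_contra h2
  rw [breaksAtStage2_iff (fun x => by simp [e12, e21, smul_sub, smul_smul, mul_comm p.1]; abel)]
    at h2
  push Not at h2
  refine h3 (eq_top_iff.2 fun v _ => ?_)
  have hp' : p.1 ≠ 0 ∨ p.2 ≠ 0 := by
    by_contra! h
    exact hp (Prod.ext h.1 h.2)
  rcases hp' with hp | hp
  -- `(v, -p₁⁻¹T₂v)` is a cycle for every `v`, so exactness in the middle already makes `T₁ - p₁`
  -- surjective. The other case is symmetric.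
  · obtain ⟨x, hx, -⟩ := h2 v (-(p.1⁻¹ • T₂ v)) (by
      simp [e12, smul_smul]
      rw [mul_inv_cancel₀ hp, one_smul, inv_mul_cancel_left₀ hp]
      abel)
    exact ⟨(0, x), by simpa [koszulDelta2] using hx⟩
  · obtain ⟨x, -, hx⟩ := h2 (-(p.2⁻¹ • T₁ v)) v (by
      simp [e21, smul_smul]
      rw [mul_inv_cancel₀ hp, one_smul, mul_comm p.1, inv_mul_cancel_left₀ hp]
      abel)
    exact ⟨(-x, 0), by simpa [koszulDelta2, neg_add_eq_sub] using hx⟩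

end KoszulExact

/-! ### Stability of exactness under perturbation -/

section Stability

variable {X Y Z : Type*} [NormedAddCommGroup X] [NormedSpace ℂ X] [NormedAddCommGroup Y]
  [NormedSpace ℂ Y] [NormedAddCommGroup Z] [NormedSpace ℂ Z]

/-- A bounded operator that solves `a x = y` up to an error `‖y‖ / 2`, with a linear bound on `x`,
is surjective. -/
theorem surjective_of_approx [CompleteSpace X] (a : X →L[ℂ] Y) (C : ℝ)
    (h : ∀ y, ∃ x, ‖y - a x‖ ≤ ‖y‖ / 2 ∧ ‖x‖ ≤ C * ‖y‖) : Function.Surjective a := by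
  intro y
  choose g hg hgC using h
  -- `u n` is the residual after `n` corrections; it halves each time, so the corrections sum to a
  -- solution.
  let u : ℕ → Y := fun n => (fun v => v - a (g v))^[n] y
  have hu : ∀ n, u (n + 1) = u n - a (g (u n)) := fun n => by
    simp only [u, Function.iterate_succ_apply']
  have hn : ∀ n, ‖u n‖ ≤ (1 / 2) ^ n * ‖y‖ := by
    intro n
    induction n with
    | zero => simp [u]
    | succ k ih =>
      rw [hu, pow_succ]
      linarith [hg (u k)]
  have hgeo : Summable fun n : ℕ => ((1 : ℝ) / 2) ^ n :=
    summable_geometric_of_lt_one (by norm_num) (by norm_num)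
  have hs : Summable fun n => g (u n) := by
    refine Summable.of_norm_bounded (g := fun n => |C| * ((1 / 2) ^ n * ‖y‖))
      ((hgeo.mul_right _).mul_left _) fun n => (hgC _).trans ?_
    gcongr
    · exact le_abs_self C
    · exact hn n
  refine ⟨∑' n, g (u n), ?_⟩
  have h1 := (hs.hasSum.mapL a).tendsto_sum_nat
  have h2 : ∀ n, ∑ i ∈ Finset.range n, a (g (u i)) = y - u n := by
    intro n
    induction n with
    | zero => simp [u]
    | succ k ih => rw [Finset.sum_range_succ, ih, hu]; abel
  have h3 : Filter.Tendsto u Filter.atTop (nhds 0) := by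
    refine squeeze_zero_norm hn ?_
    simpa using (tendsto_pow_atTop_nhds_zero_of_lt_one (r := (1 : ℝ) / 2) (by norm_num)
      (by norm_num)).mul_const ‖y‖
  simp only [h2] at h1
  exact tendsto_nhds_unique h1 (by simpa using h3.const_sub y)

/-- Exactness of `X → Y → Z → 0` at `Y` is stable under small perturbations of the complex. -/
theorem exists_forall_ker_le_range [CompleteSpace X] [CompleteSpace Y] [CompleteSpace Z]
    (α : X →L[ℂ] Y) (β : Y →L[ℂ] Z) (hex : ∀ y, β y = 0 → ∃ x, α x = y)
    (hαβ : ∀ x, β (α x) = 0) (hβ : Function.Surjective β) :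
    ∃ ε > 0, ∀ (α' : X →L[ℂ] Y) (β' : Y →L[ℂ] Z), ‖α' - α‖ ≤ ε → ‖β' - β‖ ≤ ε →
      (∀ x, β' (α' x) = 0) → ∀ y, β' y = 0 → ∃ x, α' x = y := by
  obtain ⟨C, hC, hCβ⟩ := β.exists_preimage_norm_le hβ
  have : CompleteSpace (LinearMap.ker (β : Y →ₗ[ℂ] Z)) := β.isClosed_ker.completeSpace_coe
  let α₀ : X →L[ℂ] LinearMap.ker (β : Y →ₗ[ℂ] Z) := α.codRestrict _ hαβ
  have hα₀ : Function.Surjective α₀ := fun ⟨y, hy⟩ => by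
    obtain ⟨x, hx⟩ := hex y hy
    exact ⟨x, Subtype.ext hx⟩
  obtain ⟨D, hD, hDα⟩ := α₀.exists_preimage_norm_le hα₀
  let M := C + D * 2
  -- The first bound keeps the total error below `‖y‖ / 4`; the second gives `‖v‖ ≤ ‖y‖` for the
  -- correction `v` below.
  refine ⟨min (1 / (4 * M)) (1 / C), by positivity, fun α' β' h1 h2 hc => ?_⟩
  have hM : 0 < M := by positivity
  set ε := min (1 / (4 * M)) (1 / C) with hε
  have hε0 : 0 < ε := by positivity
  have hεM : M * ε ≤ 1 / 4 := by
    calc M * ε ≤ M * (1 / (4 * M)) := by gcongr; exact min_le_left _ _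
      _ = 1 / 4 := by field_simp
  have hεC : C * ε ≤ 1 := by
    calc C * ε ≤ C * (1 / C) := by gcongr; exact min_le_right _ _
      _ = 1 := by field_simp
  let a : X →L[ℂ] LinearMap.ker (β' : Y →ₗ[ℂ] Z) := α'.codRestrict _ hc
  have hsurj : Function.Surjective a := by
    refine surjective_of_approx a (D * 2) fun ⟨y, hy⟩ => ?_
    have hy' : β' y = 0 := hy
    -- A vector of `ker β'` is almost in `ker β`: a small `v` moves it there, and an `α`-preimage of
    -- `y - v` is then an approximate `α'`-preimage of `y`.
    obtain ⟨v, hv, hvn⟩ := hCβ (β y)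
    have hβy : ‖β y‖ ≤ ε * ‖y‖ := by
      have : β y = -((β' - β) y) := by simp [hy']
      rw [this, norm_neg]
      exact (β' - β).le_of_opNorm_le h2 y
    have hvn' : ‖v‖ ≤ C * ε * ‖y‖ := by
      calc ‖v‖ ≤ C * ‖β y‖ := hvn
        _ ≤ C * (ε * ‖y‖) := by gcongr
        _ = _ := by ring
    obtain ⟨x, hx, hxn⟩ := hDα ⟨y - v, by simp [hv]⟩
    have hx' : α x = y - v := congrArg Subtype.val hx
    have hyv : ‖y - v‖ ≤ 2 * ‖y‖ := by
      have := norm_sub_le y v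
      nlinarith [norm_nonneg y]
    have hxn' : ‖x‖ ≤ D * 2 * ‖y‖ := by
      calc ‖x‖ ≤ D * ‖y - v‖ := hxn
        _ ≤ D * (2 * ‖y‖) := by gcongr
        _ = _ := by ring
    refine ⟨x, ?_, hxn'⟩
    change ‖y - α' x‖ ≤ ‖y‖ / 2
    have hd : y - α' x = v - (α' - α) x := by
      rw [_root_.sub_apply, hx']; abel
    have hdx : ‖(α' - α) x‖ ≤ ε * (D * 2 * ‖y‖) :=
      ((α' - α).le_of_opNorm_le h1 x).trans (by gcongr)
    calc ‖y - α' x‖ ≤ ‖v‖ + ‖(α' - α) x‖ := hd ▸ norm_sub_le _ _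
      _ ≤ C * ε * ‖y‖ + ε * (D * 2 * ‖y‖) := add_le_add hvn' hdx
      _ = M * ε * ‖y‖ := by simp only [M]; ring
      _ ≤ 1 / 4 * ‖y‖ := by gcongr
      _ ≤ ‖y‖ / 2 := by linarith [norm_nonneg y]
  intro y hy
  obtain ⟨x, hx⟩ := hsurj ⟨y, hy⟩
  exact ⟨x, congrArg Subtype.val hx⟩

/-- Both Koszul maps depend continuously on the point. Exactness at stage 3 supplies the
surjectivity of `δ₂` that the perturbation argument needs. -/
theorem eventually_not_breaksAtStage2 [CompleteSpace X] {T₁ T₂ : X →L[ℂ] X} (hT : Commute T₁ T₂)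
    {p : ℂ × ℂ} (h2 : ¬ BreaksAtStage2 (T₁ - p.1 • 1) (T₂ - p.2 • 1))
    (h3 : ¬ BreaksAtStage3 (T₁ - p.1 • 1) (T₂ - p.2 • 1)) :
    ∀ᶠ q in nhds p, ¬ BreaksAtStage2 (T₁ - q.1 • 1) (T₂ - q.2 • 1) := by
  have eT : ∀ x, T₁ (T₂ x) = T₂ (T₁ x) := fun x => DFunLike.congr_fun hT.eq x
  have hq : ∀ (q : ℂ × ℂ) x, (T₁ - q.1 • 1) ((T₂ - q.2 • 1) x) =
      (T₂ - q.2 • 1) ((T₁ - q.1 • 1) x) := fun q x => by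
    simp [eT, smul_sub, smul_smul, mul_comm q.1]; abel
  let α : ℂ × ℂ → X →L[ℂ] X × X := fun q => (T₁ - q.1 • 1).prod (T₂ - q.2 • 1)
  let β : ℂ × ℂ → X × X →L[ℂ] X := fun q =>
    (T₁ - q.1 • 1) ∘L ContinuousLinearMap.snd ℂ X X -
      (T₂ - q.2 • 1) ∘L ContinuousLinearMap.fst ℂ X X
  have hβα : ∀ q x, β q (α q x) = 0 := fun q x => sub_eq_zero.2 (hq q x)
  have hα : Continuous α := by
    have : Continuous fun q : ℂ × ℂ => (T₁ - q.1 • (1 : X →L[ℂ] X), T₂ - q.2 • (1 : X →L[ℂ] X)) := by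
      fun_prop
    exact (ContinuousLinearMap.prodₗᵢ ℂ :
      (X →L[ℂ] X) × (X →L[ℂ] X) ≃ₗᵢ[ℂ] _).continuous.comp this
  have hβ : Continuous β := by fun_prop
  obtain ⟨ε, hε, hst⟩ := exists_forall_ker_le_range (α p) (β p)
    (by
      rintro ⟨y₁, y₂⟩ hy
      by_contra! hn
      exact h2 ((breaksAtStage2_iff (hq p)).2
        ⟨y₁, y₂, sub_eq_zero.1 hy, fun x hx₁ hx₂ => hn x (Prod.ext hx₁ hx₂)⟩))
    (hβα p) (fun z => by
      have : LinearMap.range (koszulDelta2 (T₁ - p.1 • 1) (T₂ - p.2 • 1)) = ⊤ := not_not.1 h3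
      exact LinearMap.range_eq_top.1 this z)
  have e1 := Metric.continuous_iff'.1 hα p ε hε
  have e2 := Metric.continuous_iff'.1 hβ p ε hε
  filter_upwards [e1, e2] with q hq1 hq2
  rw [dist_eq_norm] at hq1 hq2
  rw [breaksAtStage2_iff (hq q)]
  rintro ⟨h₁, h₂, h, hn⟩
  obtain ⟨x, hx⟩ := hst (α q) (β q) hq1.le hq2.le (hβα q) (h₁, h₂) (sub_eq_zero.2 h)
  exact hn x (congrArg Prod.fst hx) (congrArg Prod.snd hx)

end Stability

/-! ### The bidisc and approximation of its boundary -/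

section Bidisc

theorem closure_openBidisc : closure openBidisc = closedBidisc := by
  rw [openBidisc, closedBidisc, closure_prod_eq, closure_ball _ one_ne_zero]

/-- Only one coordinate can be unimodular, say the first. Then `(ta, t⁻¹b)` with `t ↑ 1` keeps the
product and enters the open bidisc, because `|b| = |ab| < 1`. -/
theorem mem_closure_openBidisc_mul_eq {p : ℂ × ℂ} (hp : p ∈ closedBidisc)
    (hz : ‖p.1 * p.2‖ < 1) : p ∈ closure {q | q ∈ openBidisc ∧ q.1 * q.2 = p.1 * p.2} := by
  have key : ∀ a b : ℂ, ‖a‖ = 1 → ‖a * b‖ < 1 →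
      ∃ f : ℝ → ℂ × ℂ, Filter.Tendsto f (nhdsWithin 1 (Set.Iio 1)) (nhds (a, b)) ∧
        ∀ᶠ t in nhdsWithin 1 (Set.Iio 1), f t ∈ openBidisc ∧ (f t).1 * (f t).2 = a * b := by
    intro a b ha hab
    have hb : ‖b‖ < 1 := by simpa [ha] using hab
    let f : ℝ → ℂ × ℂ := fun t => ((t : ℂ) * a, (t : ℂ)⁻¹ * b)
    have hf : ContinuousAt f 1 := by
      refine ContinuousAt.prodMk (by fun_prop) (ContinuousAt.mul (ContinuousAt.inv₀ ?_ ?_) ?_)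
      · fun_prop
      · simp
      · fun_prop
    have hf1 : f 1 = (a, b) := by simp [f]
    have ht : Filter.Tendsto f (nhdsWithin 1 (Set.Iio 1)) (nhds (a, b)) :=
      hf1 ▸ hf.tendsto.mono_left nhdsWithin_le_nhds
    refine ⟨f, ht, ?_⟩
    have e1 : ∀ᶠ t in nhdsWithin (1 : ℝ) (Set.Iio 1), ‖(f t).2‖ < 1 :=
      ((continuous_snd.norm.tendsto _).comp ht).eventually_lt_const hb
    have e2 : ∀ᶠ t in nhdsWithin (1 : ℝ) (Set.Iio 1), (0 : ℝ) < t :=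
      nhdsWithin_le_nhds (lt_mem_nhds one_pos)
    filter_upwards [e1, e2, self_mem_nhdsWithin] with t h1 h2 h3
    have h3 : t < 1 := h3
    refine ⟨⟨?_, by simpa using h1⟩, ?_⟩
    · simpa [f, ha, abs_of_pos h2] using h3
    · have : (t : ℂ) ≠ 0 := by exact_mod_cast h2.ne'
      simp only [f]
      field_simp
  obtain ⟨a, b⟩ := p
  simp only [closedBidisc, Set.mem_prod, mem_closedBall_zero_iff] at hp
  simp only at hz ⊢
  rcases hp.1.lt_or_eq with ha | ha
  · rcases hp.2.lt_or_eq with hb | hb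
    · exact subset_closure ⟨⟨by simpa using ha, by simpa using hb⟩, rfl⟩
    · obtain ⟨f, hf, hfe⟩ := key b a hb (by rwa [mul_comm])
      refine mem_closure_of_tendsto ((continuous_swap.tendsto (b, a)).comp hf) ?_
      filter_upwards [hfe] with t ht
      exact ⟨⟨ht.1.2, ht.1.1⟩, by simpa [mul_comm] using ht.2⟩
  · obtain ⟨f, hf, hfe⟩ := key a b ha hz
    exact mem_closure_of_tendsto hf hfe

/-- A nonsingular point of the closed bidisc would have a neighbourhood free of breaks at stage 2,
yet every such neighbourhood meets the open bidisc. -/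
theorem jointSpectrum_eq_closedBidisc {X : Type*} [NormedAddCommGroup X] [NormedSpace ℂ X]
    [CompleteSpace X] {T₁ T₂ : X →L[ℂ] X} (hT : Commute T₁ T₂) (h₁ : ‖T₁‖ ≤ 1) (h₂ : ‖T₂‖ ≤ 1)
    (h : ∀ p ∈ openBidisc, BreaksAtStage2 (T₁ - p.1 • 1) (T₂ - p.2 • 1)) :
    jointSpectrum T₁ T₂ = closedBidisc := by
  refine Set.Subset.antisymm (fun p hp => norm_le_one_of_mem_jointSpectrum hT h₁ h₂ hp)
    fun p hp => ?_
  by_contra hn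
  have hn : ¬ IsSingularPair _ _ := hn
  simp only [IsSingularPair, not_or] at hn
  rw [← closure_openBidisc, mem_closure_iff_frequently] at hp
  obtain ⟨q, hq, hq'⟩ := (hp.and_eventually (eventually_not_breaksAtStage2 hT hn.2.1 hn.2.2)).exists
  exact hq' (h q hq)

end Bidisc

/-! ### Adjoints and the defect operator on the Hardy space -/

section HardyOperators

variable {E : Type*} [NormedAddCommGroup E]

/-- The constant function with value `x`. -/
def Hardy.const (x : E) : Hardy E := lp.single 2 0 x

theorem Hardy.const_zero_apply (x : E) : (Hardy.const x) 0 = x := by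
  simp [Hardy.const]

theorem Hardy.const_succ_apply (x : E) (n : ℕ) : (Hardy.const x) (n + 1) = 0 := by
  simp [Hardy.const]

variable [InnerProductSpace ℂ E]

theorem Hardy.eval_const (x : E) (z : ℂ) : Hardy.eval (Hardy.const x) z = x := by
  rw [Hardy.eval, tsum_eq_single 0]
  · simp [Hardy.const_zero_apply]
  · rintro (_ | n) hn
    · exact absurd rfl hn
    · rw [Hardy.const_succ_apply, smul_zero]

theorem mulConst_apply (A : E →L[ℂ] E) (f : Hardy E) (n : ℕ) : mulConst A f n = A (f n) := rfl

theorem mulConst_mul (A B : E →L[ℂ] E) : mulConst (A * B) = mulConst A * mulConst B := rfl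

theorem mulConst_one : mulConst (1 : E →L[ℂ] E) = 1 := rfl

theorem mulConst_sub (A B : E →L[ℂ] E) : mulConst (A - B) = mulConst A - mulConst B := rfl

theorem commute_mulConst_mulZ (A : E →L[ℂ] E) : Commute (mulConst A) mulZ := by
  ext f n
  cases n with
  | zero => exact A.map_zero
  | succ n => rfl

variable [CompleteSpace E]

theorem Hardy.eval_smul (c : ℂ) (f : Hardy E) {z : ℂ} (hz : z ∈ Metric.ball (0 : ℂ) 1) :
    Hardy.eval (c • f) z = c • Hardy.eval f z := by
  simp only [Hardy.eval, lp.coeFn_smul, Pi.smul_apply, smul_comm _ c]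
  exact (Hardy.summable f hz).tsum_const_smul c

theorem Hardy.eval_sub_smul (T : Hardy E →L[ℂ] Hardy E) (c : ℂ) (f : Hardy E) {z : ℂ}
    (hz : z ∈ Metric.ball (0 : ℂ) 1) :
    Hardy.eval ((T - c • 1) f) z = Hardy.eval (T f) z - c • Hardy.eval f z := by
  have : (T - c • 1) f = T f + (-c) • f := by simp [sub_eq_add_neg]
  rw [this, Hardy.eval_add _ _ hz, Hardy.eval_smul _ _ hz, neg_smul, sub_eq_add_neg]

theorem star_mulConst (A : E →L[ℂ] E) : star (mulConst A) = mulConst (star A) := by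
  refine ((ContinuousLinearMap.eq_adjoint_iff _ _).2 fun f g => ?_).symm
  rw [lp.inner_eq_tsum, lp.inner_eq_tsum]
  congr 1
  ext n
  exact ContinuousLinearMap.adjoint_inner_left A (g n) (f n)

theorem star_mulZ_mul_mulZ : star (mulZ : Hardy E →L[ℂ] Hardy E) * mulZ = 1 :=
  (ContinuousLinearMap.norm_map_iff_adjoint_comp_self _).1 fun f => norm_shiftSeq f

theorem star_mulZ_const (x : E) : star (mulZ (E := E)) (Hardy.const x) = 0 := by
  refine ext_inner_right ℂ fun g => ?_
  rw [ContinuousLinearMap.star_eq_adjoint, ContinuousLinearMap.adjoint_inner_left,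
    lp.inner_eq_tsum, inner_zero_left]
  refine (tsum_congr fun n => ?_).trans tsum_zero
  cases n with
  | zero => exact inner_zero_right _
  | succ n => rw [Hardy.const_succ_apply, inner_zero_left]

theorem commute_mulConst_star_mulZ (A : E →L[ℂ] E) : Commute (mulConst A) (star mulZ) := by
  have := (commute_mulConst_mulZ (star A)).star_star
  rwa [star_mulConst, star_star] at this

/-- With `Q = 1 - M_z M_z*`, the product of the two operators is `M_z`, and their range projections
are `1 - (U*PU)Q` and `1 - (1 - P)Q`; the defect is what remains. -/
theorem defect_mulPhi {P U : E →L[ℂ] E} (hP : IsStarProjection P)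
    (hU : U ∈ unitary (E →L[ℂ] E)) :
    defect (mulPhi1 P U) (mulPhi2 P U) =
      mulConst (star U * P * U - P) * (1 - mulZ * star (mulZ (E := E))) := by
  have hPs : star P = P := hP.isSelfAdjoint
  have hpp : mulConst P * mulConst P = mulConst P := by
    rw [← mulConst_mul, hP.isIdempotentElem.eq]
  have hab : mulConst (star U) * mulConst U = 1 := by
    rw [← mulConst_mul, Unitary.star_mul_self_of_mem hU, mulConst_one]
  have hba : mulConst U * mulConst (star U) = 1 := by
    rw [← mulConst_mul, Unitary.mul_star_self_of_mem hU, mulConst_one]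
  have hz : ∀ A : E →L[ℂ] E, mulConst A * mulZ = mulZ * mulConst A := commute_mulConst_mulZ
  have hz' : ∀ A : E →L[ℂ] E, mulConst A * star (mulZ (E := E)) = star (mulZ (E := E)) * mulConst A :=
    commute_mulConst_star_mulZ
  have hzz := star_mulZ_mul_mulZ (E := E)
  have assoc : ∀ {x y w : Hardy E →L[ℂ] Hardy E}, x * y = w → ∀ v, x * (y * v) = w * v :=
    fun h v => by rw [← mul_assoc, h]
  have h12 : mulPhi1 P U * mulPhi2 P U = mulZ := by
    simp only [mulPhi1, mulPhi2, mulConst_mul, mulConst_sub, mul_add, add_mul, mul_sub, sub_mul,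
      mul_one, one_mul, mul_assoc, hab, assoc hpp, assoc (hz _)]
    abel
  have h11 : mulPhi1 P U * star (mulPhi1 P U) =
      1 - mulConst (star U * P * U) * (1 - mulZ * star (mulZ (E := E))) := by
    simp only [mulPhi1, star_add, star_mul, star_mulConst, star_sub, star_star, hPs,
      mulConst_mul, mulConst_sub, mul_add, add_mul, mul_sub, sub_mul, mul_one,
      mul_assoc, hab, hz', assoc hpp, assoc (hz _), assoc (hz' _)]
    abel
  have h22 : mulPhi2 P U * star (mulPhi2 P U) =
      1 - mulConst (1 - P) * (1 - mulZ * star (mulZ (E := E))) := by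
    simp only [mulPhi2, star_add, star_mul, star_mulConst, star_sub, hPs,
      mulConst_mul, mulConst_sub, mulConst_one, mul_add, add_mul, mul_sub, sub_mul, mul_one,
      one_mul, mul_assoc, hpp, hba, hz', assoc (hz _), assoc (hz' _), assoc hba]
    abel
  have h1221 : mulPhi1 P U * mulPhi2 P U * star (mulPhi2 P U) * star (mulPhi1 P U) =
      mulZ * star (mulZ (E := E)) := by
    rw [mul_assoc, ← star_mul, h12]
  rw [defect, h1221, h11, h22]
  simp only [mulConst_sub, mulConst_one, sub_mul, one_mul]
  abel

end HardyOperators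

/-! ### Adjoints along the reducing decomposition -/

section Decomposition

variable {H : Type*} [NormedAddCommGroup H] [InnerProductSpace ℂ H]
  {K : Type*} [NormedAddCommGroup K] [InnerProductSpace ℂ K] [CompleteSpace K]
  {Hp : Submodule ℂ H} (W : K ≃ₗᵢ[ℂ] Hp)


theorem exists_eq_add_mem_orthogonal (h : H) : ∃ g : K, ∃ k : Hpᗮ, h = W g + k := by
  -- Completeness of `Hp`, inherited through the isometry, is what provides the orthogonal
  -- decomposition.
  have : CompleteSpace Hp := W.toIsometryEquiv.completeSpace_iff.1 inferInstance
  obtain ⟨y, hy, z, hz, rfl⟩ := Hp.exists_add_mem_mem_orthogonal h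
  exact ⟨W.symm ⟨y, hy⟩, ⟨z, hz⟩, by simp⟩

variable [CompleteSpace H] {V : H →L[ℂ] H} {M : K →L[ℂ] K} {W₀ : Hpᗮ ≃ₗᵢ[ℂ] Hpᗮ}

/-- Tested against `W g + k`, the cross term vanishes because `V` maps `Hpᗮ` into itself. -/
theorem star_apply_of_intertwine (hM : ∀ f, V (W f) = W (M f)) (h₀ : ∀ x : Hpᗮ, V x = W₀ x)
    (f : K) : star V (W f) = W (star M f) := by
  refine ext_inner_right ℂ fun h => ?_
  obtain ⟨g, k, rfl⟩ := exists_eq_add_mem_orthogonal W h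
  have h0 : ∀ (u : Hp) (v : Hpᗮ), ⟪(u : H), (v : H)⟫_ℂ = 0 := fun u v =>
    Submodule.inner_right_of_mem_orthogonal u.2 v.2
  rw [ContinuousLinearMap.star_eq_adjoint, ContinuousLinearMap.adjoint_inner_left, map_add, hM, h₀,
    inner_add_right, inner_add_right, h0, h0, ← Submodule.coe_inner, ← Submodule.coe_inner,
    W.inner_map_map, W.inner_map_map, ContinuousLinearMap.star_eq_adjoint,
    ContinuousLinearMap.adjoint_inner_left]

theorem star_apply_orthogonal (hV : Isometry V) (h₀ : ∀ x : Hpᗮ, V x = W₀ x) (k : Hpᗮ) :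
    star V k = W₀.symm k := by
  have h1 : star V * V = 1 := (ContinuousLinearMap.norm_map_iff_adjoint_comp_self _).1
    fun x => by simpa using hV.dist_eq x 0
  have h2 := h₀ (W₀.symm k)
  rw [W₀.apply_symm_apply] at h2
  rw [← h2]
  exact DFunLike.congr_fun h1 _

end Decomposition

/-! ### Wandering vectors from the sign of the defect -/

section Triple

variable {H : Type*} [NormedAddCommGroup H] [InnerProductSpace ℂ H] [CompleteSpace H]
  {E : Type*} [NormedAddCommGroup E] [InnerProductSpace ℂ E] [CompleteSpace E]
  {V₁ V₂ : H →L[ℂ] H} {P U : E →L[ℂ] E}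

/-- For a nonzero nonpositive defect operator, `U*` maps `ran P` into itself with a nonzero
wandering vector. -/
theorem IsBCLTriple.exists_wandering (hBCL : IsBCLTriple P U V₁ V₂) (hV₁ : Isometry V₁)
    (hV₂ : Isometry V₂) (hneg : defect V₁ V₂ ≤ 0) (hne : defect V₁ V₂ ≠ 0) :
    P * U * (1 - P) = 0 ∧ ∃ e, e ≠ 0 ∧ P e = e ∧ P (U e) = 0 := by
  obtain ⟨hP, hU, Hp, W, W₁, W₂, hM₁, hM₂, h₁, h₂⟩ := hBCL
  have hPP : ∀ x, P (P x) = P x := fun x => DFunLike.congr_fun hP.isIdempotentElem.eq x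
  have hUU : ∀ x, U (star U x) = x := fun x =>
    DFunLike.congr_fun (Unitary.mul_star_self_of_mem hU) x
  have hW : ∀ f : Hardy E, defect V₁ V₂ (W f) = W (defect (mulPhi1 P U) (mulPhi2 P U) f) := by
    intro f
    simp only [defect, add_apply, sub_apply, mul_apply_eq_comp,
      one_apply_eq_self, star_apply_of_intertwine W hM₁ h₁,
      star_apply_of_intertwine W hM₂ h₂, hM₁, hM₂, map_sub, map_add, Submodule.coe_sub,
      Submodule.coe_add]
  have hperp : ∀ k : Hpᗮ, defect V₁ V₂ k = 0 := by
    intro k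
    simp [defect, star_apply_orthogonal hV₁ h₁, star_apply_orthogonal hV₂ h₂, h₁, h₂]
  rw [defect_mulPhi hP hU] at hW
  have hPinner : ∀ x : E, ⟪P x, x⟫_ℂ = (‖P x‖ : ℂ) ^ 2 := fun x => by
    have h := ContinuousLinearMap.adjoint_inner_left P x (P x)
    rw [← ContinuousLinearMap.star_eq_adjoint, hP.isSelfAdjoint.star_eq, hPP] at h
    rw [h]
    exact inner_self_eq_norm_sq_to_K (𝕜 := ℂ) (P x)
  -- Nonpositivity is tested on constant functions, which `M_z*` kills, so only the coefficient
  -- `U*PU - P` survives.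
  have hle : ∀ x : E, ‖P (U x)‖ ≤ ‖P x‖ := by
    intro x
    have hpos := ((ContinuousLinearMap.le_def _ _).1 hneg).re_inner_nonneg_left (W (Hardy.const x))
    have hc : (mulConst (star U * P * U - P) * (1 - mulZ * star (mulZ (E := E))) :
        Hardy E →L[ℂ] Hardy E) (Hardy.const x) =
        mulConst (star U * P * U - P) (Hardy.const x) := by
      simp [star_mulZ_const]
    have hi : ⟪mulConst (star U * P * U - P) (Hardy.const x), Hardy.const x⟫_ℂ =
        ⟪(star U * P * U - P) x, x⟫_ℂ := by
      rw [lp.inner_eq_tsum, tsum_eq_single 0]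
      · rw [mulConst_apply, Hardy.const_zero_apply]
      · rintro (_ | n) hn
        · exact absurd rfl hn
        · rw [Hardy.const_succ_apply, inner_zero_right]
    have hi' : ⟪(star U * P * U - P) x, x⟫_ℂ = (‖P (U x)‖ : ℂ) ^ 2 - (‖P x‖ : ℂ) ^ 2 := by
      rw [sub_apply, inner_sub_left, hPinner, mul_apply_eq_comp,
        mul_apply_eq_comp, ContinuousLinearMap.star_eq_adjoint,
        ContinuousLinearMap.adjoint_inner_left, hPinner]
    rw [zero_sub, neg_apply, hW, hc, inner_neg_left, ← Submodule.coe_inner, W.inner_map_map,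
      hi, hi'] at hpos
    have : ‖P (U x)‖ ^ 2 ≤ ‖P x‖ ^ 2 := by
      have := hpos
      norm_cast at this
      simpa [← Complex.ofReal_pow] using this
    exact le_of_sq_le_sq this (norm_nonneg _)
  have h0 : P * U * (1 - P) = 0 := by
    ext x
    have := hle ((1 - P) x)
    simpa [hPP] using this
  refine ⟨h0, ?_⟩
  by_contra! hcon
  have h0' : ∀ x, P (U (P x)) = P (U x) := fun x => by
    have := DFunLike.congr_fun h0 x
    exact (sub_eq_zero.1 (by simpa using this)).symm
  have hstar : ∀ x, P (star U (P x)) = star U (P x) := fun x => by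
    have h := congrArg star h0
    simp only [star_mul, star_sub, star_one, hP.isSelfAdjoint.star_eq, star_zero] at h
    have := DFunLike.congr_fun h x
    exact (sub_eq_zero.1 (by simpa using this)).symm
  -- The vector `Px - U*PUx` lies in `ran P` since `U*` preserves it, and `PU` kills it since `PUP =
  -- PU`; without wandering vectors it must vanish, and the defect with it.
  have hcomm : ∀ x, star U (P (U x)) = P x := fun x => by
    by_contra hx
    refine hcon (P x - star U (P (U x))) (sub_ne_zero.2 (Ne.symm hx)) ?_ ?_
    · rw [map_sub, hPP, hstar]
    · rw [map_sub, map_sub, h0', hUU, hPP, sub_self]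
  refine hne ?_
  ext h
  obtain ⟨f, k, rfl⟩ := exists_eq_add_mem_orthogonal W h
  have hz : star U * P * U - P = 0 := by
    ext x
    simpa [sub_eq_zero] using hcomm x
  have hz' : mulConst (0 : E →L[ℂ] E) = 0 := rfl
  rw [map_add, hW, hperp, hz, hz', zero_mul]
  simp

end Triple

/-! ### The symbols at a point: contractivity, eigenvectors, cycles -/

section Symbols

variable {E : Type*} [NormedAddCommGroup E] [InnerProductSpace ℂ E]
  {P U : E →L[ℂ] E}

theorem phi2_apply (z : ℂ) (x : E) : phi2 P U z x = P (U x) + z • (U x - P (U x)) := rfl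

variable [CompleteSpace E]

theorem phi1_apply (z : ℂ) (x : E) : phi1 P U z x = star U (x - P x + z • P x) := rfl

theorem phi1_mul_phi2 (hP : IsStarProjection P) (hU : U ∈ unitary (E →L[ℂ] E)) (z : ℂ) :
    phi1 P U z * phi2 P U z = z • 1 := by
  have hPP : ∀ x, P (P x) = P x := fun x => DFunLike.congr_fun hP.isIdempotentElem.eq x
  have hUU : ∀ x, star U (U x) = x := fun x =>
    DFunLike.congr_fun (Unitary.star_mul_self_of_mem hU) x
  ext x
  change phi1 P U z (phi2 P U z x) = z • x
  rw [phi2_apply, phi1_apply]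
  simp only [map_add, map_sub, map_smul, hPP, sub_self, smul_zero, add_zero, hUU]
  module

theorem phi2_mul_phi1 (hP : IsStarProjection P) (hU : U ∈ unitary (E →L[ℂ] E)) (z : ℂ) :
    phi2 P U z * phi1 P U z = z • 1 := by
  have hPP : ∀ x, P (P x) = P x := fun x => DFunLike.congr_fun hP.isIdempotentElem.eq x
  have hUU : ∀ x, U (star U x) = x := fun x =>
    DFunLike.congr_fun (Unitary.mul_star_self_of_mem hU) x
  ext x
  change phi2 P U z (phi1 P U z x) = z • x
  rw [phi1_apply, phi2_apply, hUU]
  simp only [map_add, map_sub, map_smul, hPP, sub_self, zero_add]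
  module

/-- Pythagoras for `ran P` and its complement. Used with `P` for `φ₁` and with `1 - P` for `φ₂`. -/
theorem norm_sub_add_smul_le (hP : IsStarProjection P) {z : ℂ} (hz : ‖z‖ ≤ 1) (x : E) :
    ‖x - P x + z • P x‖ ≤ ‖x‖ := by
  have hPP : ∀ x, P (P x) = P x := fun x => DFunLike.congr_fun hP.isIdempotentElem.eq x
  have hi : ⟪x - P x, P x⟫_ℂ = 0 := by
    have h := ContinuousLinearMap.adjoint_inner_left P x (x - P x)
    rw [← ContinuousLinearMap.star_eq_adjoint, hP.isSelfAdjoint.star_eq, map_sub, hPP, sub_self,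
      inner_zero_left] at h
    exact h.symm
  have h1 := norm_add_sq_eq_norm_sq_add_norm_sq_of_inner_eq_zero (𝕜 := ℂ) (x - P x) (P x) hi
  have h2 := norm_add_sq_eq_norm_sq_add_norm_sq_of_inner_eq_zero (𝕜 := ℂ) (x - P x) (z • P x)
    (by rw [inner_smul_right, hi, mul_zero])
  rw [sub_add_cancel] at h1
  refine le_of_sq_le_sq ?_ (norm_nonneg _)
  have h3 : ‖z • P x‖ ≤ ‖P x‖ := by
    rw [norm_smul]
    exact mul_le_of_le_one_left (norm_nonneg _) hz
  nlinarith [norm_nonneg (z • P x)]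

theorem norm_phi1_le (hP : IsStarProjection P) (hU : U ∈ unitary (E →L[ℂ] E)) {z : ℂ}
    (hz : ‖z‖ ≤ 1) : ‖phi1 P U z‖ ≤ 1 :=
  ContinuousLinearMap.opNorm_le_bound _ zero_le_one fun x => by
    rw [phi1_apply, ContinuousLinearMap.norm_map_of_mem_unitary (Unitary.star_mem hU), one_mul]
    exact norm_sub_add_smul_le hP hz x

theorem norm_phi2_le (hP : IsStarProjection P) (hU : U ∈ unitary (E →L[ℂ] E)) {z : ℂ}
    (hz : ‖z‖ ≤ 1) : ‖phi2 P U z‖ ≤ 1 :=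
  ContinuousLinearMap.opNorm_le_bound _ zero_le_one fun x => by
    have h := norm_sub_add_smul_le hP.one_sub hz (U x)
    rw [ContinuousLinearMap.norm_map_of_mem_unitary hU] at h
    rw [phi2_apply, one_mul]
    simpa using h

/-- If an isometry `S` maps the kernel of the projection `Q` into itself, then the solution of
`x - c S x = v` with `|c| < 1` and `v ∈ ker Q` lies in `ker Q`. -/
theorem exists_sub_smul_eq {S Q : E →L[ℂ] E} (hS : ∀ x, ‖S x‖ = ‖x‖) (hQ : IsStarProjection Q)
    (hSQ : Q * S * (1 - Q) = 0) {c : ℂ} (hc : ‖c‖ < 1) {v : E} (hv : Q v = 0) :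
    ∃ x, x - c • S x = v ∧ Q x = 0 := by
  have hS1 : ‖S‖ ≤ 1 := S.opNorm_le_bound zero_le_one fun x => by rw [hS, one_mul]
  have hcS : ‖c • S‖ < 1 := by
    rw [norm_smul]
    exact (mul_le_of_le_one_right (norm_nonneg _) hS1).trans_lt hc
  let u := Units.oneSub (c • S) hcS
  have hx : ∀ y, (1 - c • S) ((↑u⁻¹ : E →L[ℂ] E) y) = y := fun y =>
    DFunLike.congr_fun u.mul_inv y
  set x := (↑u⁻¹ : E →L[ℂ] E) v
  have hxv : x - c • S x = v := hx v
  refine ⟨x, hxv, ?_⟩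
  have h1 : Q (S x) = Q (S (Q x)) := by
    have := DFunLike.congr_fun hSQ x
    exact sub_eq_zero.1 (by simpa using this)
  -- Since `QS = QSQ`, applying `Q` to the equation gives `‖Qx‖ ≤ |c| ‖Qx‖`, so `Qx = 0`.
  have h2 : Q x = c • Q (S (Q x)) := by
    have := congrArg Q hxv
    rw [hv, map_sub, map_smul, h1, sub_eq_zero] at this
    exact this
  have h3 : ‖Q (S (Q x))‖ ≤ ‖Q x‖ := by
    refine (Q.le_of_opNorm_le (IsStarProjection.norm_le Q hQ) _).trans ?_
    rw [hS, one_mul]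
  have h4 : ‖Q x‖ = ‖c‖ * ‖Q (S (Q x))‖ := by rw [← norm_smul, ← h2]
  have h5 : ‖Q x‖ ≤ 0 := by
    nlinarith [norm_nonneg c, norm_nonneg (Q x), mul_le_mul_of_nonneg_left h3 (norm_nonneg c)]
  exact norm_le_zero_iff.1 h5

/-- The vectors `y = ∑ λ₂ⁿ U*ⁿ e` and `w = ∑ λ₁ⁿ Uⁿ⁺¹ e` attached to a wandering vector `e`. -/
theorem exists_wandering_sums (hP : IsStarProjection P) (hU : U ∈ unitary (E →L[ℂ] E))
    (hPU : P * U * (1 - P) = 0) {e : E} (he : P e = e) (hUe : P (U e) = 0)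
    {p : ℂ × ℂ} (hp : p ∈ openBidisc) :
    ∃ y w, y - p.2 • star U y = e ∧ P y = y ∧ w - p.1 • U w = U e ∧ P w = 0 := by
  simp only [openBidisc, Set.mem_prod, mem_ball_zero_iff] at hp
  obtain ⟨w, hw, hPw⟩ := exists_sub_smul_eq
    (ContinuousLinearMap.norm_map_of_mem_unitary hU) hP hPU hp.1 hUe
  -- The adjoint relation: `U*` preserves `ran P = ker (1 - P)`, so the series for `y` stays there.
  have hPU' : (1 - P) * star U * (1 - (1 - P)) = 0 := by
    have h := congrArg star hPU
    simp only [star_mul, star_sub, star_one, hP.isSelfAdjoint.star_eq, star_zero] at h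
    rw [sub_sub_cancel, mul_assoc, h]
  obtain ⟨y, hy, hPy⟩ := exists_sub_smul_eq (v := e)
    (ContinuousLinearMap.norm_map_of_mem_unitary (Unitary.star_mem hU)) hP.one_sub hPU' hp.2
    (by simp [he])
  exact ⟨y, w, hy, (sub_eq_zero.1 (by simpa using hPy)).symm, hw, hPw⟩

/-- On `ker P` the symbol `φ₁(z)` is just `U*`, whatever `z` is. -/
theorem phi1_sub_apply_eq (hU : U ∈ unitary (E →L[ℂ] E)) {e w : E} {a : ℂ}
    (hw : w - a • U w = U e) (hPw : P w = 0) (z : ℂ) : phi1 P U z w - a • w = e := by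
  have hUU' : ∀ x, star U (U x) = x := fun x =>
    DFunLike.congr_fun (Unitary.star_mul_self_of_mem hU) x
  have := congrArg (star U : E →L[ℂ] E) hw
  rw [map_sub, map_smul, hUU', hUU'] at this
  rw [phi1_apply, hPw, smul_zero, sub_zero, add_zero, ← this]

/-- On `ran P` the operator `φ₂(z)U*` is the identity, whatever `z` is. -/
theorem phi2_sub_apply_eq (hU : U ∈ unitary (E →L[ℂ] E)) {e y : E} {b : ℂ}
    (hy : y - b • star U y = e) (hPy : P y = y) (z : ℂ) : phi2 P U z (star U y) - b • star U y = e := by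
  have hUU : ∀ x, U (star U x) = x := fun x =>
    DFunLike.congr_fun (Unitary.mul_star_self_of_mem hU) x
  rw [phi2_apply, hUU, hPy, sub_self, smul_zero, add_zero, hy]

/-- The eigenvector is `x = y + aw`, whose `P`-part is `y`. Since `Ux = by + w` is again split by
`P`, `φ₂(ab)` only multiplies `w` by `ab`, giving `bx`; `φ₁(ab)` is similar. -/
theorem isJointEigenvalue_phi (hU : U ∈ unitary (E →L[ℂ] E)) {e y w : E} {a b : ℂ}
    (hy : y - b • star U y = e) (hPy : P y = y) (hw : w - a • U w = U e) (hPw : P w = 0)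
    (he : e ≠ 0) :
    IsJointEigenvalue (phi1 P U (a * b)) (phi2 P U (a * b)) (a, b) := by
  have hUU : ∀ x, U (star U x) = x := fun x =>
    DFunLike.congr_fun (Unitary.mul_star_self_of_mem hU) x
  have hUU' : ∀ x, star U (U x) = x := fun x =>
    DFunLike.congr_fun (Unitary.star_mul_self_of_mem hU) x
  have hPx : P (y + a • w) = y := by rw [map_add, map_smul, hPy, hPw, smul_zero, add_zero]
  have hUw : a • U w = w - U e := by rw [← hw]; abel
  have hUy : U y = U e + b • y := by
    have := congrArg U hy
    rw [map_sub, map_smul, hUU, sub_eq_iff_eq_add] at this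
    exact this
  have hsw : star U w = e + a • w := by
    have := congrArg (star U : E →L[ℂ] E) hw
    rw [map_sub, map_smul, hUU', hUU', sub_eq_iff_eq_add] at this
    exact this
  have hsy : b • star U y = y - e := by rw [← hy]; abel
  have hUx : U (y + a • w) = b • y + w := by
    rw [map_add, map_smul, hUw, hUy]; abel
  refine ⟨y + a • w, fun h => ?_, ?_, ?_⟩
  · rw [h, map_zero] at hPx
    rw [← hPx, map_zero, smul_zero, sub_zero] at hy
    exact he hy.symm
  · rw [phi1_apply, hPx, map_add, map_sub, map_add, map_smul, map_smul, hsw, mul_smul, hsy]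
    module
  · rw [phi2_apply, hUx, map_add, map_smul, hPy, hPw]
    module

/-- Applying `φ₂` to `(φ₁ - a)x = U*y` and using `φ₂φ₁ = ab` turns the left side into `-a(φ₂ - b)x`,
while the right side becomes `y`. If `(φ₂ - b)x = w`, then `y = -aw` lies in both `ran P` and `ker
P`, forcing `e = 0`. -/
theorem phi_sub_ne (hP : IsStarProjection P) (hU : U ∈ unitary (E →L[ℂ] E)) {e y w : E} {a b : ℂ}
    (hy : y - b • star U y = e) (hPy : P y = y) (hPw : P w = 0) (he : e ≠ 0) (x : E)
    (h₁ : phi1 P U (a * b) x - a • x = star U y) : phi2 P U (a * b) x - b • x ≠ w := by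
  intro h₂
  have h21 : phi2 P U (a * b) (phi1 P U (a * b) x) = (a * b) • x :=
    DFunLike.congr_fun (phi2_mul_phi1 hP hU (a * b)) x
  have h := phi2_sub_apply_eq hU hy hPy (a * b)
  rw [sub_eq_iff_eq_add, ← hy, sub_add_cancel] at h
  rw [← h₁, map_sub, map_smul, h21, mul_smul, ← smul_sub] at h
  have h' : y = -(a • w) := by
    rw [← h, ← h₂]; module
  have hy0 : y = 0 := by
    rw [← hPy, h', map_neg, map_smul, hPw, smul_zero, neg_zero]
  rw [hy0, map_zero, smul_zero, sub_zero] at hy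
  exact he hy.symm

end Symbols

/-! ### Joint spectra of the symbols and of the pairs -/

section Spectra

variable {H : Type*} [NormedAddCommGroup H] [InnerProductSpace ℂ H]
  {E : Type*} [NormedAddCommGroup E] [InnerProductSpace ℂ E] [CompleteSpace E]
  {V₁ V₂ : H →L[ℂ] H} {P U : E →L[ℂ] E}

theorem commute_mulPhi (hP : IsStarProjection P) (hU : U ∈ unitary (E →L[ℂ] E)) :
    Commute (mulPhi1 P U) (mulPhi2 P U) := by
  ext1 f
  refine Hardy.eq_of_eval_eq _ _ fun z hz => ?_
  change Hardy.eval (mulPhi1 P U (mulPhi2 P U f)) z = Hardy.eval (mulPhi2 P U (mulPhi1 P U f)) z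
  rw [Hardy.eval_mulPhi1 _ _ _ hz, Hardy.eval_mulPhi2 _ _ _ hz, Hardy.eval_mulPhi2 _ _ _ hz,
    Hardy.eval_mulPhi1 _ _ _ hz]
  exact (DFunLike.congr_fun (phi1_mul_phi2 hP hU z) _).trans
    (DFunLike.congr_fun (phi2_mul_phi1 hP hU z) _).symm

theorem breaksAtStage2_phi (hP : IsStarProjection P) (hU : U ∈ unitary (E →L[ℂ] E))
    (hPU : P * U * (1 - P) = 0) {e : E} (he0 : e ≠ 0) (he : P e = e) (hUe : P (U e) = 0)
    {p : ℂ × ℂ} (hp : p ∈ openBidisc) :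
    BreaksAtStage2 (phi1 P U (p.1 * p.2) - p.1 • 1) (phi2 P U (p.1 * p.2) - p.2 • 1) := by
  obtain ⟨y, w, hy, hPy, hw, hPw⟩ := exists_wandering_sums hP hU hPU he hUe hp
  exact breaksAtStage2_of_notMem_range (h₁ := star U y) (h₂ := w)
    ((phi1_sub_apply_eq hU hw hPw _).trans (phi2_sub_apply_eq hU hy hPy _).symm)
    (phi_sub_ne hP hU hy hPy hPw he0)

theorem breaksAtStage2_mulPhi (hP : IsStarProjection P) (hU : U ∈ unitary (E →L[ℂ] E))
    (hPU : P * U * (1 - P) = 0) {e : E} (he0 : e ≠ 0) (he : P e = e) (hUe : P (U e) = 0)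
    {p : ℂ × ℂ} (hp : p ∈ openBidisc) :
    BreaksAtStage2 (mulPhi1 P U - p.1 • 1) (mulPhi2 P U - p.2 • 1) := by
  obtain ⟨y, w, hy, hPy, hw, hPw⟩ := exists_wandering_sums hP hU hPU he hUe hp
  refine breaksAtStage2_of_notMem_range (h₁ := Hardy.const (star U y)) (h₂ := Hardy.const w)
    (Hardy.eq_of_eval_eq _ _ fun z hz => ?_) fun f h₁ h₂ => ?_
  · rw [Hardy.eval_sub_smul _ _ _ hz, Hardy.eval_sub_smul _ _ _ hz, Hardy.eval_mulPhi1 _ _ _ hz,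
      Hardy.eval_mulPhi2 _ _ _ hz, Hardy.eval_const, Hardy.eval_const,
      phi1_sub_apply_eq hU hw hPw, phi2_sub_apply_eq hU hy hPy]
  -- The cycle is constant, so a preimage `f` may be evaluated at any point; `z = p₁p₂` is where the
  -- pointwise obstruction lives.
  · have hz : p.1 * p.2 ∈ Metric.ball (0 : ℂ) 1 := by
      simp only [openBidisc, Set.mem_prod, mem_ball_zero_iff] at hp ⊢
      rw [norm_mul]
      exact mul_lt_one_of_nonneg_of_lt_one_left (norm_nonneg _) hp.1 hp.2.le
    have e₁ := congrArg (Hardy.eval · (p.1 * p.2)) h₁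
    have e₂ := congrArg (Hardy.eval · (p.1 * p.2)) h₂
    simp only [Hardy.eval_sub_smul _ _ _ hz, Hardy.eval_mulPhi1 _ _ _ hz,
      Hardy.eval_mulPhi2 _ _ _ hz, Hardy.eval_const] at e₁ e₂
    exact phi_sub_ne hP hU hy hPy hPw he0 _ e₁ e₂

/-- A break of the Koszul complex at stage 2 passes from the Hardy space part to the pair. -/
theorem IsBCLTriple.breaksAtStage2 (hBCL : IsBCLTriple P U V₁ V₂) {p : ℂ × ℂ}
    (h : BreaksAtStage2 (mulPhi1 P U - p.1 • 1) (mulPhi2 P U - p.2 • 1)) :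
    BreaksAtStage2 (V₁ - p.1 • 1) (V₂ - p.2 • 1) := by
  obtain ⟨hP, hU, Hp, W, W₁, W₂, hM₁, hM₂, hW₁, hW₂⟩ := hBCL
  have hs : ∀ (S : Hardy E →L[ℂ] Hardy E) (c : ℂ), Commute S (c • 1) := fun S c =>
    (Commute.one_right S).smul_right c
  have hc : Commute (mulPhi1 P U - p.1 • 1) (mulPhi2 P U - p.2 • 1) :=
    ((commute_mulPhi hP hU).sub_right (hs _ _)).sub_left ((hs _ _).symm.sub_right (hs _ _))
  obtain ⟨f, g, hfg, hn⟩ := (breaksAtStage2_iff fun x => DFunLike.congr_fun hc.eq x).1 h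
  have key : ∀ {V : H →L[ℂ] H} {M : Hardy E →L[ℂ] Hardy E} {W₀ : Hpᗮ ≃ₗᵢ[ℂ] Hpᗮ} (c : ℂ),
      (∀ f, V (W f) = W (M f)) → (∀ x : Hpᗮ, V x = W₀ x) →
      (∀ f, (V - c • 1) (W f) = W ((M - c • 1) f)) ∧
        ∀ u v (k : Hpᗮ), (V - c • 1) (W u + k) = W v → (M - c • 1) u = v := by
    intro V M W₀ c hM h₀
    have hW : ∀ f, (V - c • 1) (W f) = W ((M - c • 1) f) := fun f => by simp [hM]
    refine ⟨hW, fun u v k hk => ?_⟩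
    have hk' : (V - c • 1) k = (W₀ k - c • k : Hpᗮ) := by simp [h₀]
    rw [map_add, hW, hk', ← sub_eq_zero, add_sub_right_comm, ← Submodule.coe_sub, ← map_sub] at hk
    -- The discrepancy lies in `Hp` by form and in `Hpᗮ` by the equation, so it is zero.
    have hm : (W ((M - c • 1) u - v) : H) ∈ Hpᗮ := by
      rw [eq_neg_of_add_eq_zero_left hk]
      exact neg_mem (W₀ k - c • k).2
    have hz := (Submodule.disjoint_def.1 Hp.orthogonal_disjoint) _ (W _).2 hm
    rw [ZeroMemClass.coe_eq_zero, map_eq_zero_iff _ W.injective, sub_eq_zero] at hz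
    exact hz
  have k₁ := key p.1 hM₁ hW₁
  have k₂ := key p.2 hM₂ hW₂
  refine breaksAtStage2_of_notMem_range (h₁ := W f) (h₂ := W g) ?_ fun x h₁ h₂ => ?_
  · rw [k₁.1, k₂.1, hfg]
  · obtain ⟨u, k, rfl⟩ := exists_eq_add_mem_orthogonal W x
    exact hn u (k₁.2 _ _ _ h₁) (k₂.2 _ _ _ h₂)

theorem jointSpectrum_phi (hP : IsStarProjection P) (hU : U ∈ unitary (E →L[ℂ] E))
    (h : ∀ p ∈ openBidisc,
      BreaksAtStage2 (phi1 P U (p.1 * p.2) - p.1 • 1) (phi2 P U (p.1 * p.2) - p.2 • 1))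
    {z : ℂ} (hz : ‖z‖ < 1) :
    jointSpectrum (phi1 P U z) (phi2 P U z) = {p | p ∈ closedBidisc ∧ p.1 * p.2 = z} ∧
      ∀ p ∈ jointSpectrum (phi1 P U z) (phi2 P U z),
        BreaksAtStage2 (phi1 P U z - p.1 • 1) (phi2 P U z - p.2 • 1) := by
  have h12 := phi1_mul_phi2 hP hU z
  have h21 := phi2_mul_phi1 hP hU z
  have hc : Commute (phi1 P U z) (phi2 P U z) := h12.trans h21.symm
  have hsub : ∀ p ∈ jointSpectrum (phi1 P U z) (phi2 P U z), p ∈ closedBidisc ∧ p.1 * p.2 = z :=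
    fun p hp => ⟨norm_le_one_of_mem_jointSpectrum hc (norm_phi1_le hP hU hz.le)
      (norm_phi2_le hP hU hz.le) hp, mul_eq_of_mem_jointSpectrum h12 h21 hp⟩
  have hbreak : ∀ p : ℂ × ℂ, p ∈ closedBidisc ∧ p.1 * p.2 = z →
      BreaksAtStage2 (phi1 P U z - p.1 • 1) (phi2 P U z - p.2 • 1) := by
    rintro p ⟨hp, rfl⟩
    -- The origin is separated because passing from stage 3 to stage 2 needs `p ≠ 0`; it lies in the
    -- open bidisc anyway. Other points are approached along the curve `q₁q₂ = z`, on which the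
    -- symbols do not change.
    rcases eq_or_ne p 0 with rfl | hp0
    · exact h 0 (by simp [openBidisc])
    by_contra hn
    have hcl := mem_closure_openBidisc_mul_eq hp hz
    rw [mem_closure_iff_frequently] at hcl
    obtain ⟨q, ⟨hq, hqz⟩, hq'⟩ := (hcl.and_eventually (eventually_not_breaksAtStage2 hc hn
      (mt (breaksAtStage2_of_breaksAtStage3 h12 h21 hp0) hn))).exists
    exact hq' (hqz ▸ h q hq)
  exact ⟨Set.Subset.antisymm hsub fun p hp => Or.inr (Or.inl (hbreak p hp)),
    fun p hp => hbreak p (hsub p hp)⟩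

theorem norm_le_one_of_isometry {V : H →L[ℂ] H} (hV : Isometry V) : ‖V‖ ≤ 1 :=
  V.opNorm_le_bound zero_le_one fun x => by simpa using (hV.dist_eq x 0).le

/-- Serves to give norm at most one, hence the upper bound on the spectrum of the multiplication
pair. -/
theorem IsBCLTriple.isometry_mulPhi (hBCL : IsBCLTriple P U V₁ V₂) (hV₁ : Isometry V₁)
    (hV₂ : Isometry V₂) : Isometry (mulPhi1 P U) ∧ Isometry (mulPhi2 P U) := by
  obtain ⟨-, -, Hp, W, -, -, hM₁, hM₂, -, -⟩ := hBCL
  have hW : Isometry fun f : Hardy E => (W f : H) := isometry_subtype_coe.comp W.isometry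
  have key : ∀ {V : H →L[ℂ] H} {M : Hardy E →L[ℂ] Hardy E}, Isometry V →
      (∀ f, V (W f) = W (M f)) → Isometry M := fun {V M} hV hM f g => by
    rw [← hW.edist_eq (M f), ← hM, ← hM, hV.edist_eq]
    exact hW.edist_eq f g
  exact ⟨key hV₁ hM₁, key hV₂ hM₂⟩

theorem closure_iUnion_eq_closedBidisc {S : ℂ → Set (ℂ × ℂ)}
    (hS : ∀ z ∈ Metric.ball (0 : ℂ) 1, S z = {p | p ∈ closedBidisc ∧ p.1 * p.2 = z}) :
    closure (⋃ z ∈ Metric.ball (0 : ℂ) 1, S z) = closedBidisc := by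
  refine Set.Subset.antisymm (closure_minimal ?_ ?_) ?_
  · refine Set.iUnion₂_subset fun z hz => ?_
    rw [hS z hz]
    exact fun p hp => hp.1
  · exact closure_openBidisc ▸ isClosed_closure
  · rw [← closure_openBidisc]
    refine closure_mono fun p hp => ?_
    have hz : p.1 * p.2 ∈ Metric.ball (0 : ℂ) 1 := by
      have hp := hp
      simp only [openBidisc, Set.mem_prod, mem_ball_zero_iff] at hp ⊢
      rw [norm_mul]
      exact mul_lt_one_of_nonneg_of_lt_one_left (norm_nonneg _) hp.1 hp.2.le
    refine Set.mem_iUnion₂.2 ⟨p.1 * p.2, hz, ?_⟩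
    rw [hS _ hz]
    exact ⟨closure_openBidisc ▸ subset_closure hp, rfl⟩

end Spectra

end IsometricPair

theorem mainTheorem2
    {H : Type*} [NormedAddCommGroup H] [InnerProductSpace ℂ H] [CompleteSpace H]
    {E : Type*} [NormedAddCommGroup E] [InnerProductSpace ℂ E] [CompleteSpace E]
    (V₁ V₂ : H →L[ℂ] H) (hV₁ : Isometry V₁) (hV₂ : Isometry V₂) (hcomm : Commute V₁ V₂)
    (hneg : IsometricPair.defect V₁ V₂ ≤ 0) (hne : IsometricPair.defect V₁ V₂ ≠ 0)
    (P U : E →L[ℂ] E) (hBCL : IsometricPair.IsBCLTriple P U V₁ V₂) :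
    (∀ z ∈ Metric.ball (0 : ℂ) 1,
      (∀ p ∈ IsometricPair.openBidisc, p.1 * p.2 = z →
        IsometricPair.IsJointEigenvalue
          (IsometricPair.phi1 P U z) (IsometricPair.phi2 P U z) p) ∧
      IsometricPair.jointSpectrum (IsometricPair.phi1 P U z) (IsometricPair.phi2 P U z) =
        {p | p ∈ IsometricPair.closedBidisc ∧ p.1 * p.2 = z} ∧
      ∀ p ∈ IsometricPair.jointSpectrum (IsometricPair.phi1 P U z) (IsometricPair.phi2 P U z),
        IsometricPair.BreaksAtStage2
          (IsometricPair.phi1 P U z - p.1 • 1) (IsometricPair.phi2 P U z - p.2 • 1)) ∧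
    IsometricPair.jointSpectrum V₁ V₂ =
      IsometricPair.jointSpectrum (IsometricPair.mulPhi1 P U) (IsometricPair.mulPhi2 P U) ∧
    IsometricPair.jointSpectrum (IsometricPair.mulPhi1 P U) (IsometricPair.mulPhi2 P U) =
      closure (⋃ z ∈ Metric.ball (0 : ℂ) 1,
        IsometricPair.jointSpectrum (IsometricPair.phi1 P U z) (IsometricPair.phi2 P U z)) ∧
    closure (⋃ z ∈ Metric.ball (0 : ℂ) 1,
        IsometricPair.jointSpectrum (IsometricPair.phi1 P U z) (IsometricPair.phi2 P U z)) =
      IsometricPair.closedBidisc ∧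
    ∀ p ∈ IsometricPair.openBidisc,
      IsometricPair.BreaksAtStage2 (V₁ - p.1 • 1) (V₂ - p.2 • 1) ∧
      IsometricPair.BreaksAtStage2
        (IsometricPair.mulPhi1 P U - p.1 • 1) (IsometricPair.mulPhi2 P U - p.2 • 1) := by
  obtain ⟨hPU, e, he0, he, hUe⟩ := hBCL.exists_wandering hV₁ hV₂ hneg hne
  have hP := hBCL.projection
  have hU := hBCL.unitary
  have hbM : ∀ p ∈ IsometricPair.openBidisc, IsometricPair.BreaksAtStage2
      (IsometricPair.mulPhi1 P U - p.1 • 1) (IsometricPair.mulPhi2 P U - p.2 • 1) :=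
    fun p hp => IsometricPair.breaksAtStage2_mulPhi hP hU hPU he0 he hUe hp
  have hbV : ∀ p ∈ IsometricPair.openBidisc,
      IsometricPair.BreaksAtStage2 (V₁ - p.1 • 1) (V₂ - p.2 • 1) :=
    fun p hp => hBCL.breaksAtStage2 (hbM p hp)
  have hsp := fun (z : ℂ) (hz : ‖z‖ < 1) => IsometricPair.jointSpectrum_phi hP hU
    (fun p hp => IsometricPair.breaksAtStage2_phi hP hU hPU he0 he hUe hp) hz
  have hσV := IsometricPair.jointSpectrum_eq_closedBidisc hcomm
    (IsometricPair.norm_le_one_of_isometry hV₁) (IsometricPair.norm_le_one_of_isometry hV₂) hbV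
  have hMi := hBCL.isometry_mulPhi hV₁ hV₂
  have hσM := IsometricPair.jointSpectrum_eq_closedBidisc (IsometricPair.commute_mulPhi hP hU)
    (IsometricPair.norm_le_one_of_isometry hMi.1) (IsometricPair.norm_le_one_of_isometry hMi.2) hbM
  have hcl := IsometricPair.closure_iUnion_eq_closedBidisc
    (S := fun z => IsometricPair.jointSpectrum (IsometricPair.phi1 P U z)
      (IsometricPair.phi2 P U z)) fun z hz => (hsp z (mem_ball_zero_iff.1 hz)).1
  refine ⟨fun z hz => ⟨fun p hp hpz => ?_, hsp z (mem_ball_zero_iff.1 hz)⟩, hσV.trans hσM.symm,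
    hσM.trans hcl.symm, hcl, fun p hp => ⟨hbV p hp, hbM p hp⟩⟩
  obtain ⟨y, w, hy, hPy, hw, hPw⟩ :=
    IsometricPair.exists_wandering_sums hP hU hPU he hUe hp
  subst hpz
  exact IsometricPair.isJointEigenvalue_phi hU hy hPy hw hPw he0
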